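/- A ribbon graph $G=(V,E)$ is a surface with boundary represented as the union of two finite sets of discs, the vertices $V$ and the edges $E$, such that vertices and edges intersect in disjoint line segments, each such segment lies on the boundary of precisely one vertex and precisely one edge, and every edge contains exactly two such segments; ribbon graphs are considered up to homeomorphisms preserving this structure. $G$ may be disconnected and non-orientable. For $A\subseteq E$, let $(V,A)$ be the spanning ribbon subgraph with edge set $A$, and let $k(A)$ and $f(A)$ be its numbers of connected components and of boundary components; put $k(G)=k(E)$ and $e(G)=|E|$. The subgraph $(V,A)$ is a spanning quasi-tree of $G$ if $k(A)=k(G)$ and every connected component of $(V,A)$ has exactly one boundary component. Let $\mathcal F$ be the set of edge sets of spanning quasi-trees of $G$, and let $D(G)=(E,\mathcal F)$ be the delta-matroid of $G$, with Bouchet's rank function \[\rho_{D(G)}(A)=|E|-\min\{|A\bigtriangleup F| : F\in\mathcal F\}.\] An edge-toggle replaces a spanning ribbon subgraph $(V,B)$ by $(V,B\bigtriangleup\{e\})$ for some $e\in E$. Theorem. Let $G=(V,E)$ be a ribbon graph. Then $\mathcal F\neq\emptyset$, and for every $A\subseteq E$ \[\rho_{D(G)}(A)=e(G)-f(A)+k(G);\]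 moreover, $|E|-\rho_{D(G)}(A)$ is the minimum number of edge-toggles needed to transform $(V,A)$ into a spanning quasi-tree of $G$. -/

import Mathlib

/-!
Ribbon graphs, up to equivalence, as discs glued along line segments.

Every edge disc `e` is a rectangle: it has two ends (labelled by a `Bool`), which are the line
segments along which it meets the vertex discs, and two free sides (labelled by a `Bool`), each
joining one end to the other.  A *corner* `(e, i, s)` is the endpoint, on the side `s`, of the line
segment at the end `i` of `e`.  The line segments are pairwise disjoint, so all corners are
distinct points, and they cut the boundary circles of the discs into arcs.
-/

/-- The corners of the edge discs: `(edge, end, side)`. -/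
abbrev Corner (E : Type*) := E × Bool × Bool

namespace Corner

/-- The other endpoint of the line segment at `x`. -/
def across {E : Type*} (x : Corner E) : Corner E := (x.1, x.2.1, !x.2.2)

/-- The other endpoint of the free side of the edge disc at `x`. -/
def along {E : Type*} (x : Corner E) : Corner E := (x.1, !x.2.1, x.2.2)

end Corner

/-- A ribbon graph with vertex set `V` and edge set `E`.

The boundary circle of a vertex disc is cut by the line segments that lie on it into these
segments and the arcs between consecutive ones; `arc x` is the other endpoint of the arc that
starts at the corner `x`. Hence every boundary circle of a vertex disc that carries a segment is a
single cycle that alternates between segments (`Corner.across`) and arcs (`arc`).  Vertices that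
are not of the form `inc e i` are isolated.  Twisted edges are allowed, so the surface need not be
orientable. -/
structure RibbonGraph (V E : Type*) where
  /-- the vertex disc that the end `i` of the edge disc `e` is attached to -/
  inc : E → Bool → V
  /-- the other endpoint of the vertex boundary arc starting at a corner -/
  arc : Corner E → Corner E
  arc_arc : ∀ x, arc (arc x) = x
  arc_ne : ∀ x, arc x ≠ x
  /-- an arc lies on the boundary of one vertex disc -/
  inc_arc : ∀ x, inc (arc x).1 (arc x).2.1 = inc x.1 x.2.1
  /-- the segments and arcs on the boundary of one vertex disc form a single circle -/
  circle : ∀ x y : Corner E, inc x.1 x.2.1 = inc y.1 y.2.1 →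
    Relation.EqvGen (fun a b => b = arc a ∨ b = a.across) x y

namespace RibbonGraph

variable {V E : Type*} (G : RibbonGraph V E)

/-- The connected components of the spanning ribbon subgraph `(V, A)`: vertices modulo the
equivalence relation generated by adjacency through an edge in `A`. -/
def Component (A : Finset E) : Type _ :=
  Quot (fun u v : V => ∃ e ∈ A, u = G.inc e false ∧ v = G.inc e true)

/-- `k(A)`: the number of connected components of `(V, A)`. -/
noncomputable def k (A : Finset E) : ℕ := Nat.card (G.Component A)

/-- The places where the boundary of `(V, A)` is sampled: all corners, and one point on the
boundary circle of every vertex disc without corners. -/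
abbrev BoundaryPoint : Type _ := Corner E ⊕ {v : V // ∀ e i, G.inc e i ≠ v}

/-- The boundary of the surface `(V, A)`, as a subset of `G`, consists of
* all arcs of the vertex discs between consecutive line segments of `G`,
* the line segments of the edges outside `A` (no edge disc of `(V, A)` is glued there),
* the two free sides of every edge in `A`,
* the boundary circles of the vertices that are isolated in `G`. -/
inductive BoundaryStep (A : Finset E) : G.BoundaryPoint → G.BoundaryPoint → Prop
  | arc (x : Corner E) : BoundaryStep A (Sum.inl x) (Sum.inl (G.arc x))
  | segment (x : Corner E) (h : x.1 ∉ A) : BoundaryStep A (Sum.inl x) (Sum.inl x.across)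
  | side (x : Corner E) (h : x.1 ∈ A) : BoundaryStep A (Sum.inl x) (Sum.inl x.along)

/-- The boundary components of the spanning ribbon subgraph `(V, A)`. -/
def BoundaryComponent (A : Finset E) : Type _ := Quot (G.BoundaryStep A)

/-- `f(A)`: the number of boundary components of `(V, A)`. -/
noncomputable def f (A : Finset E) : ℕ := Nat.card (G.BoundaryComponent A)

/-- The vertex disc that contains a given boundary point. -/
def vertexAt : G.BoundaryPoint → V
  | Sum.inl x => G.inc x.1 x.2.1
  | Sum.inr v => v.1

theorem component_eq_of_step (A : Finset E) (p q : G.BoundaryPoint) (h : G.BoundaryStep A p q) :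
    (Quot.mk _ (G.vertexAt p) : G.Component A) = Quot.mk _ (G.vertexAt q) := by
  cases h with
  | arc x => exact congrArg _ (G.inc_arc x).symm
  | segment x h => rfl
  | side x h =>
    obtain ⟨e, i, s⟩ := x
    cases i
    · exact Quot.sound ⟨e, h, rfl, rfl⟩
    · exact (Quot.sound ⟨e, h, rfl, rfl⟩).symm

/-- The connected component of `(V, A)` on whose boundary a given boundary component lies. -/
def BoundaryComponent.component {G : RibbonGraph V E} {A : Finset E} :
    G.BoundaryComponent A → G.Component A :=
  Quot.lift (fun p => Quot.mk _ (G.vertexAt p)) (G.component_eq_of_step A)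

/-- `(V, A)` is a spanning quasi-tree of `G`: it has as many connected components as `G`, and each
of its components has exactly one boundary component. -/
def IsSpanningQuasiTree [Fintype E] (A : Finset E) : Prop :=
  G.k A = G.k Finset.univ ∧ ∀ c : G.Component A, ∃! b : G.BoundaryComponent A, b.component = c

end RibbonGraph

/-- A set system on the ground set `E`, given by its feasible sets. -/
structure SetSystem (E : Type*) where
  feasible : Set (Finset E)

/-- Bouchet's rank `ρ_D(A) = |E| - min {|A ∆ F| : F feasible}`; the minimum is taken over a
nonempty set when `D` is proper, i.e. has a feasible set. -/
noncomputable def SetSystem.rank {E : Type*} [Fintype E] [DecidableEq E] (D : SetSystem E)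
    (A : Finset E) : ℤ :=
  (Fintype.card E : ℤ) - (sInf {n : ℕ | ∃ F ∈ D.feasible, n = (symmDiff A F).card} : ℕ)

/-- `D(G)`: the feasible sets are the edge sets of the spanning quasi-trees of `G`. -/
def RibbonGraph.deltaMatroid {V E : Type*} [Fintype E] (G : RibbonGraph V E) : SetSystem E where
  feasible := {F | G.IsSpanningQuasiTree F}

/-- `Toggles n A B`: the spanning ribbon subgraph `(V, B)` arises from `(V, A)` by a sequence of
`n` edge-toggles. -/
inductive Toggles {E : Type*} [DecidableEq E] : ℕ → Finset E → Finset E → Prop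
  | refl (A : Finset E) : Toggles 0 A A
  | step {n : ℕ} {A B : Finset E} (e : E) (h : Toggles n A B) :
      Toggles (n + 1) A (symmDiff B {e})

/-!
A spanning quasi-tree is exactly a subgraph with `f(A) = k(G)`, the least value `f` can take.  The
corners of an edge `e` lie on at most two boundary components of `(V, A)`.  Once these two are
merged, what is left is a quotient of the set of boundary components of the subgraph with `e`
toggled, so `f(A)` drops by at most one per toggle and at least `f(A) - k(G)` toggles are needed.

Conversely, if some edge meets two boundary components of `(V, A)`, a parity argument shows that
toggling it really merges them, so `f` drops.  If there is no such edge, then all boundary points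
at one vertex lie on one boundary component, as do those at the two ends of an edge of `G`, and so
`f(A) ≤ k(G)`.
-/

theorem even_card_of_involution {α : Type*} (s : Finset α) (g : α → α)
    (hmem : ∀ a ∈ s, g a ∈ s) (hne : ∀ a ∈ s, g a ≠ a) (hg : ∀ a ∈ s, g (g a) = a) :
    Even s.card := by
  have h : ∑ _a ∈ s, (1 : ZMod 2) = 0 :=
    Finset.sum_involution (fun a _ => g a) (fun _ _ => by decide) (fun a ha _ => hne a ha) hmem hg
  rw [Finset.sum_const, nsmul_one] at h
  exact ZMod.natCast_eq_zero_iff_even.1 h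

theorem card_le_card_add_one_of_forall_ne_mem_range {α β : Type*} [Finite β] (φ : β → α) (q : α)
    (h : ∀ a ≠ q, a ∈ Set.range φ) : Nat.card α ≤ Nat.card β + 1 := by
  rw [← Finite.card_option]
  refine Nat.card_le_card_of_surjective (fun o : Option β => o.elim q φ) fun a => ?_
  by_cases ha : a = q
  · exact ⟨none, ha.symm⟩
  · obtain ⟨b, hb⟩ := h a ha
    exact ⟨some b, hb⟩

theorem card_lt_card_of_surjective_not_injective {α β : Type*} [Finite α] (φ : α → β)
    (hs : Function.Surjective φ) (hi : ¬ Function.Injective φ) : Nat.card β < Nat.card α := by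
  by_contra! hle
  exact hi (hs.bijective_of_nat_card_le hle).1

theorem card_symmDiff_le_add {α : Type*} [DecidableEq α] (A B C : Finset α) :
    (symmDiff A C).card ≤ (symmDiff A B).card + (symmDiff B C).card :=
  (Finset.card_le_card (symmDiff_triangle A B C)).trans (Finset.card_union_le _ _)

namespace Corner

open scoped symmDiff

variable {E : Type*} [DecidableEq E] (A : Finset E)

/-- The corner joined to `x` by the part of the boundary of `(V, A)` that lies on the edge disc of
`x`: a free side if the edge is in `A`, and a line segment otherwise. -/
def mate (x : Corner E) : Corner E := if x.1 ∈ A then x.along else x.across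

@[simp] theorem mate_fst (x : Corner E) : (mate A x).1 = x.1 := by
  unfold mate; split_ifs <;> rfl

theorem mate_mate (x : Corner E) : mate A (mate A x) = x := by
  obtain ⟨e, i, s⟩ := x
  by_cases h : e ∈ A <;> simp [mate, along, across, h]

theorem mate_ne (x : Corner E) : mate A x ≠ x := by
  obtain ⟨e, i, s⟩ := x
  by_cases h : e ∈ A <;> simp [mate, along, across, h]

theorem mate_toggle_of_ne {e : E} {x : Corner E} (h : x.1 ≠ e) : mate (A ∆ {e}) x = mate A x := by
  simp [mate, Finset.mem_symmDiff, h]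

theorem eq_or_eq_mate_of_fst_eq {e : E} {x y : Corner E} (hx : x.1 = e) (hy : y.1 = e) :
    y = x ∨ y = mate A x ∨ y = mate (A ∆ {e}) x ∨ y = mate A (mate (A ∆ {e}) x) := by
  obtain ⟨e, i, s⟩ := x
  obtain ⟨e', j, t⟩ := y
  subst hx
  subst hy
  by_cases h : e' ∈ A <;> cases i <;> cases j <;> cases s <;> cases t <;>
    simp [mate, along, across, h, Finset.mem_symmDiff]

end Corner

namespace RibbonGraph

open Corner
open scoped symmDiff

variable {V E : Type*} (G : RibbonGraph V E) (A : Finset E)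

instance [Finite V] [Finite E] : Finite (G.BoundaryComponent A) :=
  Finite.of_surjective _ Quot.mk_surjective

instance [Finite V] : Finite (G.Component A) :=
  Finite.of_surjective _ Quot.mk_surjective

theorem vertexAt_surjective : Function.Surjective G.vertexAt := by
  intro v
  by_cases h : ∀ e i, G.inc e i ≠ v
  · exact ⟨Sum.inr ⟨v, h⟩, rfl⟩
  · push Not at h
    obtain ⟨e, i, rfl⟩ := h
    exact ⟨Sum.inl (e, i, false), rfl⟩

theorem component_surjective :
    Function.Surjective (BoundaryComponent.component (G := G) (A := A)) := by
  rintro ⟨v⟩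
  obtain ⟨p, rfl⟩ := G.vertexAt_surjective v
  exact ⟨Quot.mk _ p, rfl⟩

theorem k_le_f [Finite V] [Finite E] : G.k A ≤ G.f A :=
  Nat.card_le_card_of_surjective _ (G.component_surjective A)

theorem k_antitone [Finite V] : Antitone G.k := by
  intro A B hAB
  refine Nat.card_le_card_of_surjective
    (Quot.map id fun u v ⟨e, he, h⟩ => ⟨e, hAB he, h⟩ : G.Component A → G.Component B) ?_
  rintro ⟨v⟩
  exact ⟨Quot.mk _ v, rfl⟩

theorem k_univ_le_f [Finite V] [Fintype E] : G.k Finset.univ ≤ G.f A :=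
  (G.k_antitone A.subset_univ).trans (G.k_le_f A)

theorem isSpanningQuasiTree_iff_f_eq [Finite V] [Fintype E] :
    G.IsSpanningQuasiTree A ↔ G.f A = G.k Finset.univ := by
  rw [IsSpanningQuasiTree, ← Function.bijective_iff_existsUnique]
  constructor
  · rintro ⟨hk, hbij⟩
    exact (Nat.card_eq_of_bijective _ hbij).trans hk
  · intro h
    have hk : G.k A = G.k Finset.univ :=
      ((G.k_le_f A).trans h.le).antisymm (G.k_antitone A.subset_univ)
    exact ⟨hk, (G.component_surjective A).bijective_of_nat_card_le (h.trans hk.symm).le⟩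

/-- The boundary component of `(V, A)` through the corner `x`. -/
def boundaryAt (x : Corner E) : G.BoundaryComponent A := Quot.mk _ (Sum.inl x)

theorem boundaryAt_arc (x : Corner E) : G.boundaryAt A (G.arc x) = G.boundaryAt A x :=
  (Quot.sound (BoundaryStep.arc x)).symm

/-- The edge disc `e` meets only one boundary component of `(V, A)`.  For `e ∉ A` this is about the
two line segments along which `e` would be attached. -/
def IsMonofacial (e : E) : Prop :=
  ∀ x y : Corner E, x.1 = e → y.1 = e → G.boundaryAt A x = G.boundaryAt A y

variable {G A} in
theorem boundaryAt_eq_of_inc_eq (h : ∀ e, G.IsMonofacial A e) {x y : Corner E}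
    (hxy : G.inc x.1 x.2.1 = G.inc y.1 y.2.1) : G.boundaryAt A x = G.boundaryAt A y := by
  replace hxy := G.circle x y hxy
  induction hxy with
  | rel a b hab =>
    rcases hab with rfl | rfl
    · exact (G.boundaryAt_arc A a).symm
    · exact h a.1 a a.across rfl rfl
  | refl => rfl
  | symm _ _ _ ih => exact ih.symm
  | trans _ _ _ _ _ ih₁ ih₂ => exact ih₁.trans ih₂

variable {G A} in
theorem mk_eq_mk_of_vertexAt_eq (h : ∀ e, G.IsMonofacial A e) {p q : G.BoundaryPoint}
    (hpq : G.vertexAt p = G.vertexAt q) :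
    (Quot.mk _ p : G.BoundaryComponent A) = Quot.mk _ q := by
  rcases p with x | v <;> rcases q with y | w
  · exact boundaryAt_eq_of_inc_eq h hpq
  · exact absurd hpq (w.2 _ _)
  · exact absurd hpq.symm (v.2 _ _)
  · rw [Subtype.ext (show v.1 = w.1 from hpq)]

variable {G A} in
theorem f_le_k_univ_of_isMonofacial [Finite V] [Fintype E] (h : ∀ e, G.IsMonofacial A e) :
    G.f A ≤ G.k Finset.univ := by
  choose s hs using G.vertexAt_surjective
  let b (v : V) : G.BoundaryComponent A := Quot.mk _ (s v)
  have hedge (e : E) : b (G.inc e false) = b (G.inc e true) :=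
    calc
      b (G.inc e false) = G.boundaryAt A (e, false, false) := mk_eq_mk_of_vertexAt_eq h (hs _)
      _ = G.boundaryAt A (e, true, false) := h e _ _ rfl rfl
      _ = b (G.inc e true) := mk_eq_mk_of_vertexAt_eq h (hs _).symm
  refine Nat.card_le_card_of_surjective
    (Quot.lift b ?_ : G.Component Finset.univ → G.BoundaryComponent A) ?_
  · rintro _ _ ⟨e, -, rfl, rfl⟩
    exact hedge e
  · rintro ⟨p⟩
    exact ⟨Quot.mk _ (G.vertexAt p), mk_eq_mk_of_vertexAt_eq h (hs _)⟩

variable [DecidableEq E]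

theorem boundaryAt_mate (x : Corner E) : G.boundaryAt A (mate A x) = G.boundaryAt A x := by
  unfold mate
  split_ifs with h
  · exact (Quot.sound (BoundaryStep.side x h)).symm
  · exact (Quot.sound (BoundaryStep.segment x h)).symm

variable {G A} in
/-- The universal property of the set of boundary components, with the segments and sides in
`BoundaryStep` treated together as `Corner.mate`. -/
def BoundaryComponent.lift {α : Sort*} (F : G.BoundaryPoint → α)
    (harc : ∀ x, F (Sum.inl (G.arc x)) = F (Sum.inl x))
    (hmate : ∀ x, F (Sum.inl (mate A x)) = F (Sum.inl x)) : G.BoundaryComponent A → α :=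
  Quot.lift F fun _ _ h => by
    cases h with
    | arc x => exact (harc x).symm
    | segment x h => simpa only [mate, h, if_false] using (hmate x).symm
    | side x h => simpa only [mate, h, if_true] using (hmate x).symm

variable {G A} in
theorem isMonofacial_iff {e : E} {x : Corner E} (hx : x.1 = e) :
    G.IsMonofacial A e ↔ G.boundaryAt A (mate (A ∆ {e}) x) = G.boundaryAt A x := by
  refine ⟨fun h => h _ _ (by rw [mate_fst, hx]) hx, fun h => ?_⟩
  have hcorner (y : Corner E) (hy : y.1 = e) : G.boundaryAt A y = G.boundaryAt A x := by
    rcases eq_or_eq_mate_of_fst_eq A hx hy with rfl | rfl | rfl | rfl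
    · rfl
    · exact G.boundaryAt_mate A x
    · exact h
    · exact (G.boundaryAt_mate A _).trans h
  exact fun y z hy hz => (hcorner y hy).trans (hcorner z hz).symm

theorem f_le_f_toggle_add_one [Finite V] [Finite E] (e : E) : G.f A ≤ G.f (A ∆ {e}) + 1 := by
  classical
  let x : Corner E := (e, false, false)
  let p := G.boundaryAt A x
  let q := G.boundaryAt A (mate (A ∆ {e}) x)
  let merge : G.BoundaryComponent A → G.BoundaryComponent A := Function.update id q p
  have hmerge_q : merge q = p := Function.update_self ..
  have hmerge_of_ne {c : G.BoundaryComponent A} (hc : c ≠ q) : merge c = c :=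
    Function.update_of_ne hc ..
  have hmerge_p : merge p = p := by
    by_cases h : p = q
    · rw [h, hmerge_q, h]
    · exact hmerge_of_ne h
  have hcorner {y : Corner E} (hy : y.1 = e) : merge (G.boundaryAt A y) = p := by
    rcases eq_or_eq_mate_of_fst_eq A (x := x) rfl hy with rfl | rfl | rfl | rfl
    · exact hmerge_p
    · rw [boundaryAt_mate, hmerge_p]
    · exact hmerge_q
    · rw [boundaryAt_mate, hmerge_q]
  let φ : G.BoundaryComponent (A ∆ {e}) → G.BoundaryComponent A :=
    .lift (fun r => merge (Quot.mk _ r)) (fun y => congrArg merge (G.boundaryAt_arc A y))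
      fun y => by
        by_cases hy : y.1 = e
        · exact (hcorner ((mate_fst _ y).trans hy)).trans (hcorner hy).symm
        · rw [mate_toggle_of_ne A hy]
          exact congrArg merge (G.boundaryAt_mate A y)
  refine card_le_card_add_one_of_forall_ne_mem_range φ q ?_
  rintro ⟨r⟩ hr
  exact ⟨Quot.mk _ r, hmerge_of_ne hr⟩

theorem even_card_filter_fst_eq (e : E) (C : Finset (Corner E))
    (harc : ∀ y ∈ C, G.arc y ∈ C) (hmate : ∀ y ∈ C, y.1 ≠ e → mate A y ∈ C) :
    Even (C.filter fun y => y.1 = e).card := by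
  have hC : Even C.card :=
    even_card_of_involution C G.arc harc (fun y _ => G.arc_ne y) fun y _ => G.arc_arc y
  have hrest : Even (C.filter fun y => ¬ y.1 = e).card := by
    refine even_card_of_involution _ (mate A) (fun y hy => ?_) (fun y _ => mate_ne A y)
      fun y _ => mate_mate A y
    rw [Finset.mem_filter] at hy ⊢
    exact ⟨hmate y hy.1 hy.2, by rw [mate_fst]; exact hy.2⟩
  rw [← Finset.card_filter_add_card_filter_not (s := C) fun y => y.1 = e] at hC
  exact (Nat.even_add.1 hC).2 hrest

variable {G A} in
theorem boundaryAt_toggle_mate [Finite E] {e : E} (h : ¬ G.IsMonofacial A e) {y : Corner E}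
    (hy : y.1 = e) : G.boundaryAt (A ∆ {e}) (mate A y) = G.boundaryAt (A ∆ {e}) y := by
  classical
  have := Fintype.ofFinite E
  rw [isMonofacial_iff hy] at h
  let C : Finset (Corner E) := {z | G.boundaryAt A z = G.boundaryAt A y ∧
    G.boundaryAt (A ∆ {e}) z = G.boundaryAt (A ∆ {e}) y}
  have hmem (z : Corner E) : z ∈ C ↔ G.boundaryAt A z = G.boundaryAt A y ∧
      G.boundaryAt (A ∆ {e}) z = G.boundaryAt (A ∆ {e}) y := Finset.mem_filter_univ z
  have heven : Even (C.filter fun z => z.1 = e).card := by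
    refine G.even_card_filter_fst_eq A e C (fun z hz => ?_) fun z hz hze => ?_
    · rwa [hmem, boundaryAt_arc, boundaryAt_arc, ← hmem]
    · rwa [hmem, boundaryAt_mate, ← mate_toggle_of_ne A hze, boundaryAt_mate, ← hmem]
  have hpos : 0 < (C.filter fun z => z.1 = e).card :=
    Finset.card_pos.2 ⟨y, Finset.mem_filter.2 ⟨(hmem y).2 ⟨rfl, rfl⟩, hy⟩⟩
  -- By parity `C` contains a second corner of `e`, which can only be `mate A y`.
  obtain ⟨z, hz, hzy⟩ := Finset.exists_mem_ne (by grind : 1 < (C.filter fun z => z.1 = e).card) y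
  obtain ⟨hzC, hze⟩ := Finset.mem_filter.1 hz
  obtain ⟨hzA, hzB⟩ := (hmem z).1 hzC
  rcases eq_or_eq_mate_of_fst_eq A hy hze with rfl | rfl | rfl | rfl
  · exact absurd rfl hzy
  · exact hzB
  · exact absurd hzA h
  · exact absurd ((G.boundaryAt_mate A _).symm.trans hzA) h

variable {G A} in
theorem f_toggle_lt_of_not_isMonofacial [Finite V] [Finite E] {e : E}
    (h : ¬ G.IsMonofacial A e) : G.f (A ∆ {e}) < G.f A := by
  let φ : G.BoundaryComponent A → G.BoundaryComponent (A ∆ {e}) :=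
    .lift (Quot.mk _) (G.boundaryAt_arc _) fun y => by
      by_cases hy : y.1 = e
      · exact boundaryAt_toggle_mate h hy
      · rw [← mate_toggle_of_ne A hy]
        exact G.boundaryAt_mate _ y
  have hsurj : Function.Surjective φ := by
    rintro ⟨p⟩
    exact ⟨Quot.mk _ p, rfl⟩
  refine card_lt_card_of_surjective_not_injective φ hsurj fun hinj => h ?_
  exact (isMonofacial_iff (x := (e, false, false)) rfl).2
    (hinj (G.boundaryAt_mate (A ∆ {e}) (e, false, false)))

theorem exists_isSpanningQuasiTree_card_symmDiff_le [Finite V] [Fintype E] :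
    ∃ F, G.IsSpanningQuasiTree F ∧ (A ∆ F).card + G.k Finset.univ ≤ G.f A := by
  induction hm : G.f A using Nat.strong_induction_on generalizing A with
  | _ m ih =>
    subst hm
    by_cases hmono : ∀ e, G.IsMonofacial A e
    · have hf := (f_le_k_univ_of_isMonofacial hmono).antisymm (G.k_univ_le_f A)
      exact ⟨A, (G.isSpanningQuasiTree_iff_f_eq A).2 hf, by simp [hf]⟩
    · obtain ⟨e, he⟩ := not_forall.1 hmono
      have hlt := f_toggle_lt_of_not_isMonofacial he
      obtain ⟨F, hF, hcard⟩ := ih _ hlt (A ∆ {e}) rfl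
      have htri := card_symmDiff_le_add A (A ∆ {e}) F
      rw [symmDiff_symmDiff_cancel_left, Finset.card_singleton] at htri
      exact ⟨F, hF, by omega⟩

end RibbonGraph

namespace Toggles

open scoped symmDiff

variable {E : Type*} [DecidableEq E]

theorem card_symmDiff (A F : Finset E) : Toggles (A ∆ F).card A F := by
  have h (D : Finset E) : Toggles D.card A (A ∆ D) := by
    induction D using Finset.induction_on with
    | empty =>
      rw [← Finset.bot_eq_empty, symmDiff_bot]
      exact .refl A
    | insert e D he ih =>
      have hinsert : insert e D = D ∆ {e} := by
        rw [(Finset.disjoint_singleton_right.2 he).symmDiff_eq_sup, Finset.sup_eq_union,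
          Finset.union_singleton]
      rw [Finset.card_insert_of_notMem he, hinsert, ← symmDiff_assoc]
      exact .step e ih
  simpa only [symmDiff_symmDiff_cancel_left] using h (A ∆ F)

theorem f_le_f_add {V : Type*} [Finite V] [Finite E] (G : RibbonGraph V E) {n : ℕ}
    {A F : Finset E} (h : Toggles n A F) : G.f A ≤ G.f F + n := by
  induction h with
  | refl => exact le_rfl
  | @step n A B e _ ih =>
    have := G.f_le_f_toggle_add_one B e
    omega

theorem f_le_k_univ_add {V : Type*} [Finite V] [Fintype E] {G : RibbonGraph V E} {n : ℕ}
    {A F : Finset E} (h : Toggles n A F) (hF : G.IsSpanningQuasiTree F) :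
    G.f A ≤ G.k Finset.univ + n :=
  (G.isSpanningQuasiTree_iff_f_eq F).1 hF ▸ h.f_le_f_add G

end Toggles

namespace RibbonGraph

open scoped symmDiff

variable {V E : Type*} [Finite V] [Fintype E] [DecidableEq E] (G : RibbonGraph V E) (A : Finset E)

theorem exists_isSpanningQuasiTree_card_symmDiff_eq :
    ∃ F, G.IsSpanningQuasiTree F ∧ (A ∆ F).card + G.k Finset.univ = G.f A := by
  obtain ⟨F, hF, hle⟩ := G.exists_isSpanningQuasiTree_card_symmDiff_le A
  have hge := (Toggles.card_symmDiff A F).f_le_k_univ_add hF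
  exact ⟨F, hF, by omega⟩

theorem rank_deltaMatroid :
    G.deltaMatroid.rank A = (Fintype.card E : ℤ) - G.f A + G.k Finset.univ := by
  obtain ⟨F, hF, hcard⟩ := G.exists_isSpanningQuasiTree_card_symmDiff_eq A
  have hleast : IsLeast {n : ℕ | ∃ F ∈ G.deltaMatroid.feasible, n = (A ∆ F).card}
      (A ∆ F).card := by
    refine ⟨⟨F, hF, rfl⟩, ?_⟩
    rintro _ ⟨F', hF', rfl⟩
    have := (Toggles.card_symmDiff A F').f_le_k_univ_add hF'
    omega
  rw [SetSystem.rank, hleast.csInf_eq]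
  omega

end RibbonGraph

theorem theoremt {V E : Type*} [Finite V] [Fintype E] [DecidableEq E]
    (G : RibbonGraph V E) :
    G.deltaMatroid.feasible.Nonempty ∧
    ∀ A : Finset E,
      G.deltaMatroid.rank A = (Fintype.card E : ℤ) - G.f A + G.k Finset.univ ∧
      IsLeast {m : ℤ | ∃ n : ℕ, m = n ∧ ∃ F : Finset E, G.IsSpanningQuasiTree F ∧ Toggles n A F}
        ((Fintype.card E : ℤ) - G.deltaMatroid.rank A) := by
  refine ⟨?_, fun A => ⟨G.rank_deltaMatroid A, ?_, ?_⟩⟩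
  · obtain ⟨F, hF, -⟩ := G.exists_isSpanningQuasiTree_card_symmDiff_eq ∅
    exact ⟨F, hF⟩
  · obtain ⟨F, hF, hcard⟩ := G.exists_isSpanningQuasiTree_card_symmDiff_eq A
    refine ⟨(symmDiff A F).card, ?_, F, hF, Toggles.card_symmDiff A F⟩
    rw [G.rank_deltaMatroid]
    omega
  · rintro _ ⟨n, rfl, F, hF, hT⟩
    have := hT.f_le_k_univ_add hF
    rw [G.rank_deltaMatroid]
    omega
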